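/- Let $f:\mathbb{R}^n\to\mathbb{R}^n$ be locally Lipschitz, let $|\cdot|$ be the Euclidean norm, and let $W,U\subseteq\mathbb{R}^n$. For $\delta\ge 0$, a solution of the $\delta$-perturbation of the system $x(t+1)=f(x(t))$ is a sequence $(x(t))_{t=0,1,2,\dots}$ with $x(t+1)=f(x(t))+d(t)$ for some $d(t)\in\mathbb{R}^n$, $|d(t)|\le\delta$. Let $R_\delta(W)$ be the set of all points $x(t)$, $t\ge 0$, on such solutions with $x(0)\in W$, and let $\Omega=\overline{R_\delta(W)}$. Suppose that $W$ is $\delta$-robustly safe with respect to $U$ (no solution of the $\delta$-perturbation starting in $W$ ever enters $U$), that $\Omega\cap\overline{U}=\emptyset$, and that $\Omega$ is compact or $f$ is globally Lipschitz. Then for every $\delta'\in(0,\delta)$ there is a $\delta'$-robust discrete-time barrier function for $(W,U)$, that is, a continuously differentiable $B:\mathbb{R}^n\to\mathbb{R}$ such that 1. $B(x)\ge 0$ for all $x\in W$; 2. $B(x)<0$ for all $x\in U$; 3. $B(f(x)+d)\ge 0$ for all $x$ with $B(x)\ge 0$ and all $d$ with $|d|\le\delta'$. Moreover, $B$ can be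 chosen so that $B=-V$ on some open set $D\supseteq\Omega$, where $V:D\to\mathbb{R}$ is a $\delta'$-robust Lyapunov function with respect to $\Omega$: $V$ is continuously differentiable and there are class $\mathcal{K}$ functions $\alpha_1,\alpha_2,\alpha_3$ (continuous, strictly increasing functions $[0,a_i)\to\mathbb{R}$, $0<a_i\le\infty$, vanishing at $0$, with the distance $|x|_\Omega$ of $x$ to $\Omega$ in $[0,a_i)$ for all $x\in D$) such that $\alpha_1(|x|_\Omega)\le V(x)\le\alpha_2(|x|_\Omega)$ for all $x\in D$, and $f(x)+d\in D$ and $V(f(x)+d)-V(x)\le-\alpha_3(|x|_\Omega)$ for all $x\in D$ and all $d$ with $|d|\le\delta'$. -/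

import Mathlib

open Set Metric

namespace DiscreteBarrier

/-- The state space `ℝⁿ` with the Euclidean norm. -/
abbrev State (n : ℕ) : Type := EuclideanSpace ℝ (Fin n)

variable {n : ℕ}

/-- `x` is a solution of the `δ`-perturbation of `x(t+1) = f(x(t))`, i.e. of
`x(t+1) = f(x(t)) + d(t)` with an arbitrary disturbance sequence `|d(t)| ≤ δ`. -/
def IsSolution (f : State n → State n) (δ : ℝ) (x : ℕ → State n) : Prop :=
  ∃ d : ℕ → State n, (∀ t, ‖d t‖ ≤ δ) ∧ ∀ t, x (t + 1) = f (x t) + d t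

/-- The points reached at time `t` by solutions of the `δ`-perturbation that start in `W`. -/
def reachAt (f : State n → State n) (δ : ℝ) (W : Set (State n)) (t : ℕ) : Set (State n) :=
  {y | ∃ x : ℕ → State n, IsSolution f δ x ∧ x 0 ∈ W ∧ x t = y}

/-- The reachable set `R_δ(W)`, the union over all times `t ≥ 0`. -/
def reach (f : State n → State n) (δ : ℝ) (W : Set (State n)) : Set (State n) :=
  ⋃ t : ℕ, reachAt f δ W t

/-- `W` is `δ`-robustly safe with respect to `U`: no solution of the `δ`-perturbation that
starts in `W` ever enters `U`. -/
def IsRobustlySafe (f : State n → State n) (δ : ℝ) (W U : Set (State n)) : Prop :=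
  ∀ x : ℕ → State n, IsSolution f δ x → x 0 ∈ W → ∀ t, x t ∉ U

/-- `B` is a `δ`-robust discrete-time barrier function for `(W, U)`. -/
structure IsRobustBarrier (f : State n → State n) (δ : ℝ) (W U : Set (State n))
    (B : State n → ℝ) : Prop where
  contDiff : ContDiff ℝ 1 B
  nonneg : ∀ x ∈ W, 0 ≤ B x
  neg : ∀ x ∈ U, B x < 0
  step : ∀ x, 0 ≤ B x → ∀ d : State n, ‖d‖ ≤ δ → 0 ≤ B (f x + d)

/-- The interval `[0, a)`, where `a` may be `∞`. -/
def interval (a : ENNReal) : Set ℝ := {s | 0 ≤ s ∧ ENNReal.ofReal s < a}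

/-- `α : [0, a) → ℝ` (with `0 < a ≤ ∞`) is of class `K`: continuous, strictly increasing and
zero at `0`. Values of `α` outside `[0, a)` play no role. -/
structure IsClassK (a : ENNReal) (α : ℝ → ℝ) : Prop where
  pos : 0 < a
  continuousOn : ContinuousOn α (interval a)
  strictMonoOn : StrictMonoOn α (interval a)
  map_zero : α 0 = 0

/-- `V : D → ℝ` is a `δ`-robust Lyapunov function for `x(t+1) = f(x(t))` with respect to the
closed set `A`, on the open set `D ⊇ A`. Distances `|x|_A` of points of `D` are required to lie
in the domains of the class `K` functions, and `f x + d` in the domain `D` of `V`. Values of `V`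
outside `D` play no role. -/
structure IsRobustLyapunov (f : State n → State n) (δ : ℝ) (A D : Set (State n))
    (V : State n → ℝ) : Prop where
  isClosed : IsClosed A
  isOpen : IsOpen D
  subset : A ⊆ D
  contDiffOn : ContDiffOn ℝ 1 V D
  lower : ∃ (a : ENNReal) (α : ℝ → ℝ), IsClassK a α ∧
    ∀ x ∈ D, infDist x A ∈ interval a ∧ α (infDist x A) ≤ V x
  upper : ∃ (a : ENNReal) (α : ℝ → ℝ), IsClassK a α ∧
    ∀ x ∈ D, infDist x A ∈ interval a ∧ V x ≤ α (infDist x A)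
  decrease : ∃ (a : ENNReal) (α : ℝ → ℝ), IsClassK a α ∧
    ∀ x ∈ D, infDist x A ∈ interval a ∧
      ∀ d : State n, ‖d‖ ≤ δ → f x + d ∈ D ∧ V (f x + d) - V x ≤ -α (infDist x A)

end DiscreteBarrier

open MeasureTheory Filter Topology
open scoped Convolution NNReal

namespace DiscreteBarrier

/-! ### A continuously differentiable surrogate for the distance to a closed set -/

/-! By continuity Ω inherits δ-invariance from the reachable set. If x is close to y ∈ Ω, then f x +
d = f y + (f x - f y + d), and the slack δ - δ' absorbs f x - f y. So δ'-perturbations send a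
uniform neighbourhood of Ω into Ω in one step (`exists_thickening_add_mem`). Hence any C¹ function V
that vanishes exactly on Ω and is bounded on both sides by class K functions of the distance works,
with B = -V: after one step V is 0. Such a V (`exists_contDiff_comparable_infDist`) is ∑ 2⁻ᵏ max(gₖ
- 2⁻ᵏ, 0)², where gₖ is a mollification of u = min(dist, 1) within 2⁻ᵏ of u. The shift makes each
term vanish on Ω, the square makes it C¹, and the common Lipschitz constant of the gₖ gives
convergence in C¹. -/

lemma hasDerivAt_max_zero_sq (t : ℝ) : HasDerivAt (fun t : ℝ => max t 0 ^ 2) (2 * max t 0) t := by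
  rcases lt_trichotomy t 0 with ht | rfl | ht
  · rw [max_eq_right ht.le, mul_zero]
    refine (hasDerivAt_const t (0 : ℝ)).congr_of_eventuallyEq ?_
    filter_upwards [gt_mem_nhds ht] with s hs
    simp [max_eq_right hs.le]
  · rw [hasDerivAt_iff_isLittleO_nhds_zero]
    have h : (fun h : ℝ => h ^ 2) =o[𝓝 0] fun h => h := by
      simpa using Asymptotics.isLittleO_pow_pow (𝕜 := ℝ) (show 1 < 2 by norm_num)
    refine Asymptotics.IsBigO.trans_isLittleO (Asymptotics.IsBigO.of_bound 1 ?_) h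
    refine Eventually.of_forall fun s => ?_
    have hs : |max s 0| ≤ |s| := by
      rcases max_cases s 0 with ⟨h, _⟩ | ⟨h, _⟩ <;> simp [h]
    simpa using sq_le_sq.2 hs
  · rw [max_eq_left ht.le]
    have h : HasDerivAt (fun s : ℝ => s ^ 2) (2 * t) t := by simpa using hasDerivAt_pow 2 t
    refine h.congr_of_eventuallyEq ?_
    filter_upwards [lt_mem_nhds ht] with s hs
    simp [max_eq_left hs.le]

lemma contDiff_max_zero_sq : ContDiff ℝ 1 (fun t : ℝ => max t 0 ^ 2) := by
  rw [contDiff_one_iff_deriv]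
  refine ⟨fun t => (hasDerivAt_max_zero_sq t).differentiableAt, ?_⟩
  rw [funext fun t => (hasDerivAt_max_zero_sq t).deriv]
  fun_prop

lemma abs_max_zero_sq_sub_le {a b : ℝ} (ha : a ≤ 1) (hb : b ≤ 1) :
    |max a 0 ^ 2 - max b 0 ^ 2| ≤ 2 * |a - b| := by
  have h1 : |max a 0 - max b 0| ≤ |a - b| := abs_max_sub_max_le_abs a b 0
  have h2 : |max a 0 + max b 0| ≤ 2 := by
    rw [abs_of_nonneg (add_nonneg (le_max_right _ _) (le_max_right _ _))]
    linarith [max_le ha zero_le_one, max_le hb zero_le_one]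
  rw [sq_sub_sq, abs_mul]
  exact mul_le_mul h2 h1 (abs_nonneg _) zero_le_two

/-! ### Mollification of Lipschitz functions -/

section Approximation

variable {E : Type*} [NormedAddCommGroup E] [InnerProductSpace ℝ E] [FiniteDimensional ℝ E]

/-- A Lipschitz function is uniformly approximated by smooth functions with the same Lipschitz
constant. -/
lemma exists_contDiff_lipschitzWith_dist_le {u : E → ℝ} {K : ℝ≥0} (hu : LipschitzWith K u)
    {ε : ℝ} (hε : 0 < ε) :
    ∃ g : E → ℝ, ContDiff ℝ 1 g ∧ LipschitzWith K g ∧ ∀ x, |g x - u x| ≤ K * ε := by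
  borelize E
  let φ : ContDiffBump (0 : E) := ⟨ε / 2, ε, by positivity, by linarith⟩
  let μ : Measure E := volume
  have hint : ∀ x, Integrable (fun t => φ.normed μ t * u (x - t)) μ := fun x => by
    refine Continuous.integrable_of_hasCompactSupport ?_ ?_
    · exact φ.continuous_normed.mul (hu.continuous.comp (continuous_const.sub continuous_id))
    · exact (φ.hasCompactSupport_normed (μ := μ)).mul_right
  -- An average of translates of `u` keeps its Lipschitz constant.
  refine ⟨(φ.normed μ ⋆[ContinuousLinearMap.lsmul ℝ ℝ, μ] u), ?_, ?_, fun x => ?_⟩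
  · exact HasCompactSupport.contDiff_convolution_left _ (φ.hasCompactSupport_normed (μ := μ))
      (φ.contDiff_normed (n := 1)) hu.continuous.locallyIntegrable
  · refine LipschitzWith.of_dist_le_mul fun x y => ?_
    simp only [convolution_lsmul, smul_eq_mul, Real.dist_eq]
    rw [← integral_sub (hint x) (hint y)]
    calc |∫ t, φ.normed μ t * u (x - t) - φ.normed μ t * u (y - t) ∂μ|
        ≤ ∫ t, φ.normed μ t * (K * dist x y) ∂μ := by
          rw [← Real.norm_eq_abs]
          refine norm_integral_le_of_norm_le ((φ.integrable_normed (μ := μ)).mul_const _)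
            (Eventually.of_forall fun t => ?_)
          rw [← mul_sub, Real.norm_eq_abs, abs_mul, abs_of_nonneg (φ.nonneg_normed t)]
          refine mul_le_mul_of_nonneg_left ?_ (φ.nonneg_normed t)
          simpa [Real.dist_eq] using hu.dist_le_mul (x - t) (y - t)
      _ = K * dist x y := by rw [integral_mul_const, φ.integral_normed, one_mul]
  · rw [← Real.dist_eq]
    refine φ.dist_normed_convolution_le hu.continuous.aestronglyMeasurable fun y hy => ?_
    refine (hu.dist_le_mul y x).trans ?_
    gcongr
    exact (mem_ball.1 hy).le

end Approximation

/-- The lower comparison function for the smoothed distance. -/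
noncomputable def lowerGauge (s : ℝ) : ℝ :=
  ∑' k : ℕ, (1 / 2 : ℝ) ^ k * max (s - 2 * (1 / 2) ^ k) 0 ^ 2

lemma lowerGauge_term_le {s : ℝ} (hs : s ≤ 1) (k : ℕ) :
    (1 / 2 : ℝ) ^ k * max (s - 2 * (1 / 2) ^ k) 0 ^ 2 ≤ (1 / 2) ^ k := by
  have h0 : (0 : ℝ) < (1 / 2) ^ k := by positivity
  refine mul_le_of_le_one_right h0.le (pow_le_one₀ (le_max_right _ _) (max_le ?_ zero_le_one))
  linarith

lemma lowerGauge_summable {s : ℝ} (hs : s ≤ 1) :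
    Summable fun k : ℕ => (1 / 2 : ℝ) ^ k * max (s - 2 * (1 / 2) ^ k) 0 ^ 2 :=
  Summable.of_nonneg_of_le (fun _ => by positivity) (lowerGauge_term_le hs) summable_geometric_two

lemma lowerGauge_continuousOn : ContinuousOn lowerGauge (Icc 0 1) := by
  refine continuousOn_tsum (u := fun k : ℕ => (1 / 2 : ℝ) ^ k) (fun k => by fun_prop)
    summable_geometric_two fun k s hs => ?_
  rw [Real.norm_of_nonneg (by positivity)]
  exact lowerGauge_term_le hs.2 k

lemma lowerGauge_strictMonoOn : StrictMonoOn lowerGauge (Icc 0 1) := by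
  intro s hs t ht hst
  have h2 : 0 < t / 2 := by linarith [hs.1]
  -- All terms are monotone; the `k`-th is already positive at `t`, so it increases strictly.
  obtain ⟨k, hk⟩ := exists_pow_lt_of_lt_one h2 (show (1 / 2 : ℝ) < 1 by norm_num)
  refine Summable.tsum_lt_tsum (i := k) (fun j => ?_) ?_ (lowerGauge_summable hs.2)
    (lowerGauge_summable ht.2)
  · gcongr
  · have h0 : (0 : ℝ) < (1 / 2) ^ k := by positivity
    refine mul_lt_mul_of_pos_left (pow_lt_pow_left₀ ?_ (le_max_right _ _) two_ne_zero) h0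
    refine max_lt (lt_max_of_lt_left (by linarith)) (lt_max_of_lt_left (by linarith))

lemma lowerGauge_zero : lowerGauge 0 = 0 := by
  refine (tsum_congr fun k => ?_).trans tsum_zero
  have h0 : (0 : ℝ) < (1 / 2) ^ k := by positivity
  rw [max_eq_right (by linarith)]
  simp

lemma interval_one_subset : interval 1 ⊆ Icc 0 1 := fun s hs =>
  ⟨hs.1, by simpa using ((ENNReal.ofReal_lt_iff_lt_toReal hs.1 ENNReal.one_ne_top).1 hs.2).le⟩

lemma isClassK_lowerGauge : IsClassK 1 lowerGauge where
  pos := one_pos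
  continuousOn := lowerGauge_continuousOn.mono interval_one_subset
  strictMonoOn := lowerGauge_strictMonoOn.mono interval_one_subset
  map_zero := lowerGauge_zero

lemma isClassK_two_mul_sq : IsClassK 1 (fun s => 2 * s ^ 2) where
  pos := one_pos
  continuousOn := by fun_prop
  strictMonoOn := fun s hs t _ hst => by
    have := pow_lt_pow_left₀ hst hs.1 two_ne_zero
    simpa using this
  map_zero := by simp

/-! ### C¹ substitute for the distance -/

section SmoothedDistance

variable {E : Type*} [NormedAddCommGroup E] [InnerProductSpace ℝ E] [FiniteDimensional ℝ E]

/-- On a Euclidean space there is a `C¹` function comparable, uniformly, with the distance to a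
given set. -/
lemma exists_contDiff_comparable_infDist (A : Set E) :
    ∃ V : E → ℝ, ContDiff ℝ 1 V ∧ ∀ x, lowerGauge (min (infDist x A) 1) ≤ V x ∧
      V x ≤ 2 * (min (infDist x A) 1) ^ 2 := by
  set u : E → ℝ := fun x => min (infDist x A) 1 with hu
  have hu0 : ∀ x, 0 ≤ u x := fun x => le_min infDist_nonneg zero_le_one
  have hu1 : ∀ x, u x ≤ 1 := fun x => min_le_right _ _
  have hulip : LipschitzWith 1 u := (lipschitz_infDist_pt A).min_const 1
  choose g hgC hgL hgu using fun k : ℕ =>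
    exists_contDiff_lipschitzWith_dist_le hulip (show (0 : ℝ) < (1 / 2) ^ k by positivity)
  simp only [NNReal.coe_one, one_mul, abs_le] at hgu
  set T : ℕ → E → ℝ := fun k x => (1 / 2 : ℝ) ^ k * max (g k x - (1 / 2) ^ k) 0 ^ 2 with hT
  have hgle : ∀ k x, g k x - (1 / 2) ^ k ≤ u x := fun k x => by linarith [(hgu k x).2]
  have hgge : ∀ k x, u x - 2 * (1 / 2) ^ k ≤ g k x - (1 / 2) ^ k :=
    fun k x => by linarith [(hgu k x).1]
  have hT0 : ∀ k x, 0 ≤ T k x := fun k x => by positivity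
  have hTu : ∀ k x, T k x ≤ (1 / 2) ^ k * u x ^ 2 := fun k x => by
    refine mul_le_mul_of_nonneg_left ?_ (by positivity)
    exact pow_le_pow_left₀ (le_max_right _ _) (max_le (hgle k x) (hu0 x)) 2
  have hTsum : ∀ x, Summable fun k => T k x := fun x =>
    Summable.of_nonneg_of_le (fun k => hT0 k x) (fun k => hTu k x)
      (summable_geometric_two.mul_right _)
  have hTC : ∀ k, ContDiff ℝ 1 (T k) := fun k =>
    contDiff_const.mul (contDiff_max_zero_sq.comp ((hgC k).sub contDiff_const))
  have hTL : ∀ k, LipschitzWith ((1 / 2) ^ k * 2) (T k) := fun k => by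
    refine LipschitzWith.of_dist_le_mul fun x y => ?_
    have h1 := abs_max_zero_sq_sub_le ((hgle k x).trans (hu1 x)) ((hgle k y).trans (hu1 y))
    have h2 := (hgL k).dist_le_mul x y
    rw [Real.dist_eq, NNReal.coe_one, one_mul] at h2
    rw [sub_sub_sub_cancel_right] at h1
    rw [Real.dist_eq, hT]
    simp only
    rw [← mul_sub, abs_mul, abs_of_nonneg (show (0 : ℝ) ≤ (1 / 2) ^ k by positivity)]
    push_cast
    rw [mul_assoc]
    gcongr
    linarith
  refine ⟨fun x => ∑' k, T k x, ?_, fun x => ⟨?_, ?_⟩⟩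
  · refine contDiff_tsum (N := 1) (v := fun _ k => (1 / 2 : ℝ) ^ k * 2) hTC
      (fun _ _ => summable_geometric_two.mul_right _) fun m k x hm => ?_
    have hm' : m ≤ 1 := by exact_mod_cast hm
    have h0 : (0 : ℝ) < (1 / 2) ^ k := by positivity
    interval_cases m
    · rw [norm_iteratedFDeriv_zero, Real.norm_of_nonneg (hT0 k x)]
      refine (hTu k x).trans (mul_le_mul_of_nonneg_left ?_ h0.le)
      linarith [pow_le_one₀ (n := 2) (hu0 x) (hu1 x)]
    -- The Lipschitz constant bounds the first derivative.
    · rw [norm_iteratedFDeriv_one]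
      simpa using norm_fderiv_le_of_lipschitz ℝ (hTL k) (x₀ := x)
  · refine Summable.tsum_le_tsum (fun k => ?_) (lowerGauge_summable (hu1 x)) (hTsum x)
    have := hgge k x
    simp only [hT]
    gcongr
  · calc ∑' k, T k x ≤ ∑' k : ℕ, (1 / 2 : ℝ) ^ k * u x ^ 2 :=
          Summable.tsum_le_tsum (fun k => hTu k x) (hTsum x)
            (summable_geometric_two.mul_right _)
      _ = 2 * u x ^ 2 := by rw [tsum_mul_right, tsum_geometric_two]

end SmoothedDistance

/-! ### Invariance of the reachable set -/

section Reach

variable {n : ℕ} {f : State n → State n} {δ : ℝ} {W : Set (State n)}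

lemma subset_reach (f : State n → State n) (hδ : 0 ≤ δ) (W : Set (State n)) :
    W ⊆ reach f δ W := fun w hw =>
  mem_iUnion.2 ⟨0, fun t => f^[t] w, ⟨fun _ => 0, fun _ => by simpa using hδ, fun t => by
    simp [Function.iterate_succ_apply']⟩, hw, rfl⟩

lemma add_mem_reach {y d : State n} (hy : y ∈ reach f δ W) (hd : ‖d‖ ≤ δ) :
    f y + d ∈ reach f δ W := by
  obtain ⟨t, x, ⟨e, he, hx⟩, hx0, rfl⟩ := mem_iUnion.1 hy
  -- Changing the disturbance at time `t` alone leaves the trajectory up to `t` intact.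
  let e' : ℕ → State n := Function.update e t d
  let x' : ℕ → State n := fun s => Nat.rec (x 0) (fun s z => f z + e' s) s
  have hx' : ∀ s, x' (s + 1) = f (x' s) + e' s := fun _ => rfl
  have hagree : ∀ s ≤ t, x' s = x s := by
    intro s
    induction s with
    | zero => exact fun _ => rfl
    | succ s ih =>
      intro hs
      rw [hx', hx, ih (by omega)]
      simp only [e', Function.update_of_ne (show s ≠ t by omega)]
  refine mem_iUnion.2 ⟨t + 1, x', ⟨e', fun s => ?_, hx'⟩, hx0, ?_⟩
  · rcases eq_or_ne s t with rfl | hs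
    · simpa [e'] using hd
    · simpa [e', Function.update_of_ne hs] using he s
  · rw [hx', hagree t le_rfl]
    simp [e']

lemma add_mem_closure_reach (hf : Continuous f) {y d : State n}
    (hy : y ∈ closure (reach f δ W)) (hd : ‖d‖ ≤ δ) : f y + d ∈ closure (reach f δ W) :=
  map_mem_closure (f := fun z => f z + d) (by fun_prop) hy fun _ hz => add_mem_reach hz hd

/-- If `f` is uniformly continuous at the points of a set `A` that is invariant under
`δ`-perturbations, then `δ'`-perturbations with `δ' < δ` carry a whole uniform neighbourhood
of `A` into `A`. -/
lemma exists_thickening_add_mem {A : Set (State n)} {δ' : ℝ} (hδ : δ' < δ)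
    (hA : ∀ y ∈ A, ∀ d : State n, ‖d‖ ≤ δ → f y + d ∈ A)
    (hf : ∀ ε > 0, ∃ η > 0, ∀ y ∈ A, ∀ x, dist x y < η → dist (f x) (f y) < ε) :
    ∃ η > 0, ∀ x ∈ thickening η A, ∀ d : State n, ‖d‖ ≤ δ' → f x + d ∈ A := by
  obtain ⟨η, hη, h⟩ := hf (δ - δ') (sub_pos.2 hδ)
  refine ⟨η, hη, fun x hx d hd => ?_⟩
  obtain ⟨y, hy, hxy⟩ := mem_thickening_iff.1 hx
  have h1 := h y hy x hxy
  rw [dist_eq_norm] at h1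
  have h2 := hA y hy (f x - f y + d) ((norm_add_le _ _).trans (by linarith))
  rwa [← add_assoc, add_sub_cancel] at h2

/-- Here `x` ranges over the whole space, so uniform continuity of `f` restricted to `A` would not
suffice. -/
lemma exists_dist_lt_of_isCompact_or_lipschitz {A : Set (State n)} (hf : Continuous f)
    (h : IsCompact A ∨ ∃ K, LipschitzWith K f) :
    ∀ ε > 0, ∃ η > 0, ∀ y ∈ A, ∀ x, dist x y < η → dist (f x) (f y) < ε := by
  intro ε hε
  rcases h with hA | ⟨K, hK⟩
  · obtain ⟨η, hη, h⟩ := mem_uniformity_dist.1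
      (hA.uniformContinuousAt_of_continuousAt f (fun _ _ => hf.continuousAt)
        (dist_mem_uniformity hε))
    refine ⟨η, hη, fun y hy x hxy => ?_⟩
    rw [dist_comm]
    exact h (by rwa [dist_comm]) hy
  · obtain ⟨η, hη, h⟩ := Metric.uniformContinuous_iff.1 hK.uniformContinuous ε hε
    exact ⟨η, hη, fun y _ x hxy => h hxy⟩

end Reach

/-- A closed nonempty set `A` disjoint from `U` and containing `W`, invariant under
`δ'`-perturbations uniformly near `A`, is the zero superlevel set of a barrier function whose
negative is a Lyapunov function near `A`. -/
lemma exists_barrier_of_thickening {n : ℕ} {f : State n → State n} {δ' η : ℝ}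
    {A W U : Set (State n)} (hA : IsClosed A) (hne : A.Nonempty) (hW : W ⊆ A)
    (hU : Disjoint A U) (hη : 0 < η)
    (hstep : ∀ x ∈ thickening η A, ∀ d : State n, ‖d‖ ≤ δ' → f x + d ∈ A) :
    ∃ B : State n → ℝ, IsRobustBarrier f δ' W U B ∧
      ∃ D : Set (State n), IsRobustLyapunov f δ' A D (fun x => -B x) := by
  obtain ⟨V, hVC, hV⟩ := exists_contDiff_comparable_infDist A
  have hzero : ∀ x ∈ A, V x = 0 := fun x hx => by
    have h := hV x
    rw [infDist_zero_of_mem hx, min_eq_left zero_le_one, lowerGauge_zero] at h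
    exact le_antisymm (by simpa using h.2) h.1
  have hpos : ∀ x ∉ A, 0 < V x := fun x hx => by
    have h0 : 0 < min (infDist x A) 1 :=
      lt_min ((hA.notMem_iff_infDist_pos hne).1 hx) one_pos
    have h1 := lowerGauge_strictMonoOn (left_mem_Icc.2 zero_le_one)
      ⟨h0.le, min_le_right _ _⟩ h0
    rw [lowerGauge_zero] at h1
    exact h1.trans_le (hV x).1
  have hmem : ∀ x, 0 ≤ -V x → x ∈ A := fun x hx => by
    by_contra h
    linarith [hpos x h]
  -- Within distance 1 of `A` the truncation min(dist, 1) is inactive.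
  have hsub : A ⊆ thickening (min η 1) A := self_subset_thickening (lt_min hη one_pos) A
  have hη' : ∀ x ∈ thickening (min η 1) A, x ∈ thickening η A := fun x hx =>
    thickening_mono (min_le_left _ _) A hx
  have hdist : ∀ x ∈ thickening (min η 1) A, infDist x A < 1 := fun x hx => by
    obtain ⟨y, hy, hxy⟩ := mem_thickening_iff.1 hx
    exact (infDist_le_dist_of_mem hy).trans_lt (hxy.trans_le (min_le_right _ _))
  have hint : ∀ x ∈ thickening (min η 1) A, infDist x A ∈ interval 1 := fun x hx =>
    ⟨infDist_nonneg, ENNReal.ofReal_lt_one.2 (hdist x hx)⟩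
  have hVD : ∀ x ∈ thickening (min η 1) A,
      lowerGauge (infDist x A) ≤ V x ∧ V x ≤ 2 * infDist x A ^ 2 := fun x hx => by
    simpa only [min_eq_left (hdist x hx).le] using hV x
  refine ⟨fun x => -V x, ⟨hVC.neg, fun x hx => ?_, fun x hx => ?_, fun x hx d hd => ?_⟩,
    thickening (min η 1) A, ?_⟩
  · simp [hzero x (hW hx)]
  · exact neg_neg_of_pos (hpos x fun h => hU.notMem_of_mem_left h hx)
  · simp [hzero _ (hstep x (hη' x (hsub (hmem x hx))) d hd)]
  · simp only [neg_neg]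
    exact {
      isClosed := hA
      isOpen := isOpen_thickening
      subset := hsub
      contDiffOn := hVC.contDiffOn
      lower := ⟨1, _, isClassK_lowerGauge, fun x hx => ⟨hint x hx, (hVD x hx).1⟩⟩
      upper := ⟨1, _, isClassK_two_mul_sq, fun x hx => ⟨hint x hx, (hVD x hx).2⟩⟩
      decrease := ⟨1, _, isClassK_lowerGauge, fun x hx => ⟨hint x hx, fun d hd => by
        have h := hstep x (hη' x hx) d hd
        refine ⟨hsub h, ?_⟩
        rw [hzero _ h]
        linarith [(hVD x hx).1]⟩⟩ }

/-- With nothing to keep safe, a negative constant is a barrier function. -/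
lemma exists_barrier_empty {n : ℕ} (f : State n → State n) (δ' : ℝ) (U : Set (State n)) :
    ∃ B : State n → ℝ, IsRobustBarrier f δ' ∅ U B ∧
      ∃ D : Set (State n), IsRobustLyapunov f δ' ∅ D (fun x => -B x) := by
  -- `infDist` to `∅` is 0 by convention, so the distance construction fails here; `D = ∅` makes the
  -- Lyapunov conditions vacuous.
  refine ⟨fun _ => -1, ⟨contDiff_const, by simp, by simp, fun x hx => ?_⟩, ∅, ?_⟩
  · norm_num at hx
  · exact ⟨isClosed_empty, isOpen_empty, le_rfl, contDiffOn_const,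
      ⟨1, _, isClassK_lowerGauge, by simp⟩, ⟨1, _, isClassK_lowerGauge, by simp⟩,
      ⟨1, _, isClassK_lowerGauge, by simp⟩⟩

end DiscreteBarrier

theorem theorem5 {n : ℕ} (f : DiscreteBarrier.State n → DiscreteBarrier.State n)
    (hf : LocallyLipschitz f) (W U : Set (DiscreteBarrier.State n)) (δ : ℝ)
    (hsafe : DiscreteBarrier.IsRobustlySafe f δ W U)
    (hdisj : closure (DiscreteBarrier.reach f δ W) ∩ closure U = ∅)
    (hΩ : IsCompact (closure (DiscreteBarrier.reach f δ W)) ∨ ∃ K, LipschitzWith K f)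
    (δ' : ℝ) (hδ' : δ' ∈ Set.Ioo 0 δ) :
    ∃ B : DiscreteBarrier.State n → ℝ,
      DiscreteBarrier.IsRobustBarrier f δ' W U B ∧
      ∃ D : Set (DiscreteBarrier.State n),
        DiscreteBarrier.IsRobustLyapunov f δ' (closure (DiscreteBarrier.reach f δ W)) D
          (fun x => -B x) := by
  have hδ : 0 ≤ δ := hδ'.1.le.trans hδ'.2.le
  have hW : W ⊆ closure (DiscreteBarrier.reach f δ W) :=
    (DiscreteBarrier.subset_reach f hδ W).trans subset_closure
  rcases (closure (DiscreteBarrier.reach f δ W)).eq_empty_or_nonempty with hempty | hne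
  · obtain rfl : W = ∅ := subset_empty_iff.1 (hempty ▸ hW)
    rw [hempty]
    exact DiscreteBarrier.exists_barrier_empty f δ' U
  · obtain ⟨η, hη, hstep⟩ := DiscreteBarrier.exists_thickening_add_mem hδ'.2
      (fun y hy d hd => DiscreteBarrier.add_mem_closure_reach hf.continuous hy hd)
      (DiscreteBarrier.exists_dist_lt_of_isCompact_or_lipschitz hf.continuous hΩ)
    exact DiscreteBarrier.exists_barrier_of_thickening isClosed_closure hne hW
      ((disjoint_iff_inter_eq_empty.2 hdisj).mono_right subset_closure) hη hstep
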